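/- Let $(E,\mathcal E,\pi)$ be a probability space and let $(D,\mathcal D(D))$ be a densely defined, closed, non-negative symmetric bilinear form on the real space $L^2(\pi)$ with $1\in\mathcal D(D)$ and $D(1)=0$, where $D(f):=D(f,f)$. Let $(P_t)_{t\ge 0}$ be the semigroup determined by the form, i.e. the strongly continuous semigroup on $L^2(\pi)$ whose infinitesimal generator $L$ is given by: $f\in\mathrm{Dom}(L)$ and $Lf=g$ if and only if $f\in\mathcal D(D)$ and $D(f,h)=-\langle g,h\rangle$ for all $h\in\mathcal D(D)$. Write $\pi(f)=\int f\,d\pi$ and $\mathrm{Var}(f)=\pi(f^2)-\pi(f)^2$, and set $D(f)=\infty$ for $f\notin\mathcal D(D)$. Let $p,q\in(1,\infty)$ with $1/p+1/q=1$ and let $V:L^2(\pi)\to[0,\infty]$ be a functional. The Liggett–Stroock inequality says that there is a constant $C\in(0,\infty)$ with $$\mathrm{Var}(f)\le C\,D(f)^{1/p}\,V(f)^{1/q}\qquad\text{for all } f\in L^2(\pi),$$ where the right-hand side is understood to be $\infty$ if $D(f)=\infty$ or $V(f)=\infty$. Consider also the decay property that there is a constant $C\in(0,\infty)$ with $$\mathrm{Var}(P_tf)\le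 C\,V(f)/t^{\,q-1}\qquad\text{for all } t>0,\ f\in L^2(\pi).\tag{14}$$ 1. If $V(P_tf)\le V(f)$ for all $t\ge0$ and $f\in L^2(\pi)$, then the Liggett–Stroock inequality implies (14). This condition on $V$ holds automatically when $V(f)=\|f\|_r^2$ with $1\le r\le\infty$ and the form is Markovian (i.e. for every $f\in\mathcal D(D)$, $(f\vee0)\wedge1\in\mathcal D(D)$ and $D((f\vee0)\wedge1)\le D(f)$). 2. Conversely, (14) implies the Liggett–Stroock inequality (without any further condition on $V$). (The constants $C$ in the two inequalities may differ.) 3. For every $c>0$, the Poincaré inequality $\mathrm{Var}(f)\le c^{-1}D(f)$ for all $f\in L^2(\pi)$ is equivalent to $\mathrm{Var}(P_tf)\le \mathrm{Var}(f)\,e^{-2ct}$ for all $t\ge0$ and $f\in L^2(\pi)$. In particular, with the spectral gap $\lambda_1:=\inf\{D(f):\pi(f)=0,\ \|f\|_2=1\}$, the Poincaré inequality $\mathrm{Var}(f)\le C\,D(f)$ holds for some constant $C\in(0,\infty)$ if and only if $\lambda_1>0$ and $\mathrm{Var}(P_tf)\le\mathrm{Var}(f)\,e^{-2\lambda_1t}$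 for all $t\ge0$ and $f\in L^2(\pi)$. (If $L^2(\pi)$ contains only constants, then $\lambda_1=\infty$, all variances vanish, and both sides hold trivially.) -/

import Mathlib

open MeasureTheory ProbabilityTheory Filter Topology Set
open scoped ENNReal

/-- A symmetric form `(D, 𝓓(D))` on the real Hilbert space `L²(π)`: a densely defined, non-negative,
symmetric bilinear form that is closed (its domain is complete for `D(f,f) + ‖f‖²`), so that it
determines a semigroup on `L²(π)`. -/
structure SymmetricForm {E : Type*} [MeasurableSpace E] (π : Measure E) where
  /-- the domain `𝓓(D)` -/
  domain : Submodule ℝ (Lp ℝ 2 π)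
  /-- the bilinear form `D(f, g)` for `f, g` in the domain -/
  form : domain →ₗ[ℝ] domain →ₗ[ℝ] ℝ
  symm : ∀ f g, form f g = form g f
  nonneg : ∀ f, 0 ≤ form f f
  dense : Dense (domain : Set (Lp ℝ 2 π))
  closed : ∀ (u : ℕ → domain) (f : Lp ℝ 2 π),
    Tendsto (fun n => (u n : Lp ℝ 2 π)) atTop (𝓝 f) →
    (∀ ε > 0, ∃ N, ∀ m ≥ N, ∀ n ≥ N, form (u m - u n) (u m - u n) < ε) →
    ∃ hf : f ∈ domain,
      Tendsto (fun n => form (u n - ⟨f, hf⟩) (u n - ⟨f, hf⟩)) atTop (𝓝 0)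

namespace SymmetricForm

variable {E : Type*} [MeasurableSpace E] {π : Measure E}

/-- Constants belong to the domain and have zero energy: `1 ∈ 𝓓(D)` and `D(1) = 0`. -/
def IsConservative [IsFiniteMeasure π] (D : SymmetricForm π) : Prop :=
  ∃ h : Lp.const 2 π (1 : ℝ) ∈ D.domain, D.form ⟨_, h⟩ ⟨_, h⟩ = 0

/-- The Markov (Dirichlet) property: the unit contraction `(f ∨ 0) ∧ 1` operates on the form. -/
def IsMarkovian [IsFiniteMeasure π] (D : SymmetricForm π) : Prop :=
  ∀ f : D.domain, ∃ h : ((f : Lp ℝ 2 π) ⊔ 0) ⊓ Lp.const 2 π (1 : ℝ) ∈ D.domain,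
    D.form ⟨_, h⟩ ⟨_, h⟩ ≤ D.form f f

/-- `(P_t)_{t ≥ 0}` is the semigroup determined by the form: it is the strongly continuous semigroup
on `L²(π)` whose infinitesimal generator `L` is the operator of the form, that is,
`f ∈ Dom(L)` and `L f = g` if and only if `f ∈ 𝓓(D)` and `D(f, h) = -⟨g, h⟩` for all `h ∈ 𝓓(D)`.
Only the values of `P` at `t ≥ 0` matter. -/
structure IsSemigroup (D : SymmetricForm π) (P : ℝ → Lp ℝ 2 π →L[ℝ] Lp ℝ 2 π) : Prop where
  zero : P 0 = ContinuousLinearMap.id ℝ (Lp ℝ 2 π)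
  add : ∀ s t, 0 ≤ s → 0 ≤ t → P (s + t) = (P s).comp (P t)
  cont : ∀ f, ContinuousOn (fun t => P t f) (Ici 0)
  generator : ∀ f g : Lp ℝ 2 π,
    Tendsto (fun t : ℝ => t⁻¹ • (P t f - f)) (𝓝[>] 0) (𝓝 g) ↔
      ∃ hf : f ∈ D.domain, ∀ h : D.domain, D.form ⟨f, hf⟩ h = -inner ℝ g (h : Lp ℝ 2 π)

/-- Poincaré inequality `Var(f) ≤ C D(f)`. With `D(f) = ∞` off the domain, only `f ∈ 𝓓(D)`
matters. -/
def Poincare (D : SymmetricForm π) (C : ℝ) : Prop :=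
  ∀ f : D.domain, variance (f : Lp ℝ 2 π) π ≤ C * D.form f f

/-- Liggett–Stroock inequality `Var(f) ≤ C D(f)^{1/p} V(f)^{1/q}`; the right-hand side is understood
to be `∞` as soon as `D(f) = ∞` (that is, `f ∉ 𝓓(D)`) or `V(f) = ∞`. -/
def LiggettStroock (D : SymmetricForm π) (V : Lp ℝ 2 π → ℝ≥0∞) (p q C : ℝ) : Prop :=
  ∀ f : D.domain, V f ≠ ∞ →
    variance (f : Lp ℝ 2 π) π ≤ C * D.form f f ^ (1 / p) * (V f).toReal ^ (1 / q)

/-- The spectral gap `λ₁ = inf {D(f) : π(f) = 0, ‖f‖ = 1}`, with value `∞` if there is no such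
`f`. -/
noncomputable def spectralGap (D : SymmetricForm π) : ℝ≥0∞ :=
  ⨅ (f : D.domain) (_ : ∫ x, (f : Lp ℝ 2 π) x ∂π = 0) (_ : ‖(f : Lp ℝ 2 π)‖ = 1),
    ENNReal.ofReal (D.form f f)

end SymmetricForm

/-- `L²`-algebraic convergence `Var(P_t f) ≤ C V(f) / t^{q-1}` for all `t > 0` (there is nothing to
say if `V(f) = ∞`). -/
def AlgebraicDecay {E : Type*} [MeasurableSpace E] {π : Measure E}
    (P : ℝ → Lp ℝ 2 π →L[ℝ] Lp ℝ 2 π) (V : Lp ℝ 2 π → ℝ≥0∞) (q C : ℝ) : Prop :=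
  ∀ f, V f ≠ ∞ → ∀ t : ℝ, 0 < t → variance (P t f) π ≤ C * (V f).toReal / t ^ (q - 1)

/-- Exponential `L²`-convergence `Var(P_t f) ≤ Var(f) exp(-2 c t)` for all `t ≥ 0`. -/
def ExponentialDecay {E : Type*} [MeasurableSpace E] {π : Measure E}
    (P : ℝ → Lp ℝ 2 π →L[ℝ] Lp ℝ 2 π) (c : ℝ) : Prop :=
  ∀ f : Lp ℝ 2 π, ∀ t : ℝ, 0 ≤ t →
    variance (P t f) π ≤ variance f π * Real.exp (-2 * c * t)

/-! Everything rests on two estimates: `Var(P_t f) + 2t D(P_t f) ≤ Var(f)` for every `f`, and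
`Var(f) ≤ Var(P_t f) + 2t D(f)` for `f` in the form domain (`variance_add_form_le`,
`variance_le_add_form`). Both would follow from the spectral theorem. Here they come from the
generator alone: energy differentiation gives contraction and symmetry, symmetry gives `P_t =
P_{t/2}² ≥ 0`, and hence the product of `1 - P_s` and `1 - P_t` is non-negative, so energy decreases
along the semigroup. Since `P_t` fixes `1`, it preserves means, and norms become variances.

Liggett–Stroock to decay: the first estimate, started at time `s/2`, bounds `D(P_s f)` by
`Var(P_{s/2} f)/s`. The resulting recursion between times `s` and `s/2` is closed by a supremum
argument. Decay to Liggett–Stroock: insert the decay into the second estimate and optimize in `t`.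
Poincaré to exponential decay: iterate the first estimate over `n` steps of length `t/n`;
conversely, differentiate the second at `t = 0`.

For a Markovian form, the `L²`-distance to the convex set `{0 ≤ g ≤ 1}` decreases along the
semigroup, so this set is invariant and `P_t` is positive. Affine minorants then give Jensen's
inequality and the `L^r` contractions. -/

namespace SymmetricForm

/-! ### Generator calculus: density of the generator domain, contraction and symmetry of the
semigroup -/

variable {E : Type*} [MeasurableSpace E] {π : Measure E} {D : SymmetricForm π}
  {P : ℝ → Lp ℝ 2 π →L[ℝ] Lp ℝ 2 π}

/-- `D.IsGenerator f g` says that `f` is in the domain of the operator `L` of the form and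
`L f = g`. -/
def IsGenerator (D : SymmetricForm π) (f g : Lp ℝ 2 π) : Prop :=
  ∃ hf : f ∈ D.domain, ∀ h : D.domain, D.form ⟨f, hf⟩ h = -inner ℝ g (h : Lp ℝ 2 π)

lemma IsGenerator.smul {f g : Lp ℝ 2 π} (h : D.IsGenerator f g) (c : ℝ) :
    D.IsGenerator (c • f) (c • g) := by
  obtain ⟨hf, h⟩ := h
  refine ⟨D.domain.smul_mem c hf, fun k => ?_⟩
  have : (⟨c • f, D.domain.smul_mem c hf⟩ : D.domain) = c • ⟨f, hf⟩ := rfl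
  rw [this, map_smul, LinearMap.smul_apply, h, real_inner_smul_left, smul_eq_mul]
  ring

lemma IsGenerator.sub {f g f' g' : Lp ℝ 2 π} (h : D.IsGenerator f g) (h' : D.IsGenerator f' g') :
    D.IsGenerator (f - f') (g - g') := by
  obtain ⟨hf, h⟩ := h
  obtain ⟨hf', h'⟩ := h'
  refine ⟨D.domain.sub_mem hf hf', fun k => ?_⟩
  have : (⟨f - f', D.domain.sub_mem hf hf'⟩ : D.domain) = ⟨f, hf⟩ - ⟨f', hf'⟩ := rfl
  rw [this, map_sub, LinearMap.sub_apply, h, h', inner_sub_left]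
  ring

lemma IsGenerator.inner_nonpos {f g : Lp ℝ 2 π} (h : D.IsGenerator f g) : inner ℝ g f ≤ 0 := by
  obtain ⟨hf, h⟩ := h
  have := D.nonneg ⟨f, hf⟩
  rw [h] at this
  simpa using this

lemma form_sq_le (f g : D.domain) : D.form f g ^ 2 ≤ D.form f f * D.form g g := by
  have := LinearMap.BilinForm.apply_mul_apply_le_of_forall_zero_le D.form D.nonneg f g
  rwa [D.symm g f, ← sq] at this

/-- Translation by `-s` maps the right neighbourhoods of `s` to those of `0`. -/
lemma tendsto_sub_self_nhdsGT (s : ℝ) : Tendsto (fun z => z - s) (𝓝[>] s) (𝓝[>] 0) := by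
  refine tendsto_nhdsWithin_iff.2 ⟨?_, ?_⟩
  · have : Tendsto (fun z => z - s) (𝓝 s) (𝓝 (s - s)) := (continuous_sub_right s).tendsto s
    rw [sub_self] at this
    exact this.mono_left nhdsWithin_le_nhds
  · filter_upwards [self_mem_nhdsWithin] with z hz
    exact sub_pos.2 (mem_Ioi.1 hz)

namespace IsSemigroup

lemma tendsto_iff (hP : D.IsSemigroup P) {f g : Lp ℝ 2 π} :
    Tendsto (fun t : ℝ => t⁻¹ • (P t f - f)) (𝓝[>] 0) (𝓝 g) ↔ D.IsGenerator f g :=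
  hP.generator f g

lemma zero_apply (hP : D.IsSemigroup P) (f : Lp ℝ 2 π) : P 0 f = f := by
  rw [hP.zero]; rfl

lemma add_apply (hP : D.IsSemigroup P) {s t : ℝ} (hs : 0 ≤ s) (ht : 0 ≤ t) (f : Lp ℝ 2 π) :
    P (s + t) f = P s (P t f) := by
  rw [hP.add s t hs ht]; rfl

lemma comm_apply (hP : D.IsSemigroup P) {s t : ℝ} (hs : 0 ≤ s) (ht : 0 ≤ t) (f : Lp ℝ 2 π) :
    P s (P t f) = P t (P s f) := by
  rw [← hP.add_apply hs ht, ← hP.add_apply ht hs, add_comm]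

lemma isGenerator_apply (hP : D.IsSemigroup P) {f g : Lp ℝ 2 π} (h : D.IsGenerator f g) {t : ℝ}
    (ht : 0 ≤ t) : D.IsGenerator (P t f) (P t g) := by
  rw [← hP.tendsto_iff] at h ⊢
  refine (((P t).continuous.tendsto g).comp h).congr' ?_
  filter_upwards [self_mem_nhdsWithin] with s hs
  simp only [Function.comp, map_smul, map_sub]
  rw [hP.comm_apply ht (le_of_lt hs)]

lemma hasDerivWithinAt (hP : D.IsSemigroup P) {f g : Lp ℝ 2 π} (h : D.IsGenerator f g) {s : ℝ}
    (hs : 0 ≤ s) : HasDerivWithinAt (fun t => P t f) (P s g) (Ici s) s := by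
  have h1 := hP.tendsto_iff.2 (hP.isGenerator_apply h hs)
  rw [hasDerivWithinAt_iff_tendsto_slope, Ici_sdiff_left]
  refine (h1.comp (tendsto_sub_self_nhdsGT s)).congr' ?_
  filter_upwards [self_mem_nhdsWithin] with z hz
  have hz' : 0 ≤ z - s := by simpa using le_of_lt hz
  simp only [Function.comp, slope_def_module]
  rw [← hP.add_apply hz' hs, sub_add_cancel]

lemma continuous_max (hP : D.IsSemigroup P) (f : Lp ℝ 2 π) :
    Continuous (fun t => P (max t 0) f) := by
  have := hP.cont f
  exact this.comp_continuous (by fun_prop) (fun t => le_max_right t 0)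

lemma continuousOn_apply (hP : D.IsSemigroup P) (f : Lp ℝ 2 π) {a b : ℝ} (ha : 0 ≤ a) :
    ContinuousOn (fun t => P t f) (Icc a b) :=
  (hP.cont f).mono fun _ hx => ha.trans hx.1

/-- The averages `ε⁻¹ ∫₀^ε P_s f ds` are in the domain of the generator. -/
lemma isGenerator_average (hP : D.IsSemigroup P) (f : Lp ℝ 2 π) {ε : ℝ} (hε : 0 < ε) :
    D.IsGenerator (ε⁻¹ • ∫ s in (0 : ℝ)..ε, P (max s 0) f) (ε⁻¹ • (P ε f - f)) := by
  refine IsGenerator.smul ?_ _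
  -- The truncation `max s 0` makes the integrand continuous on all of `ℝ`, so the two-sided
  -- fundamental theorem of calculus applies.
  have hc := hP.continuous_max f
  have hd : ∀ t, HasDerivAt (fun u => ∫ s in (0 : ℝ)..u, P (max s 0) f) (P (max t 0) f) t :=
    fun t => (hc.integral_hasStrictDerivAt 0 t).hasDerivAt
  have hshift : HasDerivAt (fun h => (∫ s in (0 : ℝ)..(h + ε), P (max s 0) f) -
      ∫ s in (0 : ℝ)..h, P (max s 0) f) (P ε f - f) 0 := by
    have h1 := HasDerivAt.comp_add_const 0 ε (f := fun u => ∫ s in (0 : ℝ)..u, P (max s 0) f)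
      (hd (0 + ε))
    have h2 := h1.sub (hd 0)
    simpa [max_eq_left hε.le, hP.zero_apply] using! h2
  rw [← hP.tendsto_iff]
  rw [hasDerivAt_iff_tendsto_slope] at hshift
  refine (hshift.mono_left (nhdsWithin_mono 0 fun x hx => ne_of_gt hx)).congr' ?_
  filter_upwards [self_mem_nhdsWithin] with h hh
  have hh0 : (0 : ℝ) ≤ h := le_of_lt hh
  have key : P h (∫ s in (0 : ℝ)..ε, P (max s 0) f) = (∫ s in (0 : ℝ)..(h + ε), P (max s 0) f) -
      ∫ s in (0 : ℝ)..h, P (max s 0) f := by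
    rw [← ContinuousLinearMap.intervalIntegral_comp_comm _ (hc.intervalIntegrable _ _)]
    rw [intervalIntegral.integral_interval_sub_left (hc.intervalIntegrable _ _)
      (hc.intervalIntegrable _ _)]
    have : ∫ s in (0 : ℝ)..ε, P (max (s + h) 0) f = ∫ s in h..(h + ε), P (max s 0) f := by
      rw [intervalIntegral.integral_comp_add_right (fun s => P (max s 0) f), zero_add, add_comm ε]
    rw [← this]
    refine intervalIntegral.integral_congr fun s hs => ?_
    rw [uIcc_of_le hε.le] at hs
    rw [max_eq_left hs.1, max_eq_left (add_nonneg hs.1 hh0), ← hP.add_apply hh0 hs.1, add_comm]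
  simp [slope_def_module, key]

lemma tendsto_average (hP : D.IsSemigroup P) (f : Lp ℝ 2 π) :
    Tendsto (fun ε : ℝ => ε⁻¹ • ∫ s in (0 : ℝ)..ε, P (max s 0) f) (𝓝[>] 0) (𝓝 f) := by
  have hd := ((hP.continuous_max f).integral_hasStrictDerivAt 0 0).hasDerivAt
  rw [hasDerivAt_iff_tendsto_slope] at hd
  simpa [slope_fun_def, hP.zero_apply] using
    hd.mono_left (nhdsWithin_mono 0 fun x (hx : x ∈ Ioi 0) => ne_of_gt hx)

/-- The domain of the generator is dense. -/
lemma dense_generator (hP : D.IsSemigroup P) : Dense {f : Lp ℝ 2 π | ∃ g, D.IsGenerator f g} := by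
  intro f
  refine mem_closure_of_tendsto (hP.tendsto_average f) ?_
  filter_upwards [self_mem_nhdsWithin] with ε hε
  exact ⟨_, hP.isGenerator_average f hε⟩

/-- The right derivative of `‖P_s f‖²` is `2⟨P_s f, L P_s f⟩ = -2 D(P_s f) ≤ 0`. -/
lemma norm_apply_le_of_isGenerator (hP : D.IsSemigroup P) {f g : Lp ℝ 2 π}
    (h : D.IsGenerator f g) {t : ℝ} (ht : 0 ≤ t) : ‖P t f‖ ≤ ‖f‖ := by
  have h1 : ∀ s ∈ Ico 0 t, HasDerivWithinAt (fun s => ‖P s f‖ ^ 2)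
      (2 * inner ℝ (P s f) (P s g)) (Ici s) s :=
    fun s hs => (hP.hasDerivWithinAt h hs.1).norm_sq
  have := image_le_of_deriv_right_le_deriv_boundary (f := fun s => ‖P s f‖ ^ 2)
    (((hP.continuousOn_apply f le_rfl).norm).pow 2) h1 (B := fun _ => ‖f‖ ^ 2) (B' := fun _ => 0)
    (by simp [hP.zero_apply]) continuousOn_const (fun x _ => hasDerivWithinAt_const _ _ _)
    (fun s hs => by
      have := (hP.isGenerator_apply h hs.1).inner_nonpos
      rw [real_inner_comm]; linarith) (right_mem_Icc.2 ht)
  exact le_of_sq_le_sq this (norm_nonneg _)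

lemma norm_apply_le (hP : D.IsSemigroup P) {t : ℝ} (ht : 0 ≤ t) (f : Lp ℝ 2 π) :
    ‖P t f‖ ≤ ‖f‖ := by
  have hc : IsClosed {f : Lp ℝ 2 π | ‖P t f‖ ≤ ‖f‖} :=
    isClosed_le (by fun_prop) (by fun_prop)
  exact hP.dense_generator.induction
    (fun f ⟨_, h⟩ => hP.norm_apply_le_of_isGenerator h ht) hc f

lemma _root_.SymmetricForm.IsGenerator.symm {f g f' g' : Lp ℝ 2 π} (h : D.IsGenerator f f')
    (h' : D.IsGenerator g g') : inner ℝ f' g = inner ℝ f g' := by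
  obtain ⟨hf, h⟩ := h
  obtain ⟨hg, h'⟩ := h'
  have h1 := h ⟨g, hg⟩
  have h2 := h' ⟨f, hf⟩
  rw [D.symm, h2] at h1
  simpa [real_inner_comm] using h1.symm

/-- The function `s ↦ ⟨P_s f, P_{t-s} g⟩` has right derivative `⟨L P_s f, P_{t-s} g⟩ - ⟨P_s f, L
P_{t-s} g⟩ = 0`, hence equal values at `s = 0` and `s = t`. -/
lemma symm_of_isGenerator (hP : D.IsSemigroup P) {f g f' g' : Lp ℝ 2 π}
    (h : D.IsGenerator f f') (h' : D.IsGenerator g g') {t : ℝ} (ht : 0 ≤ t) :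
    inner ℝ (P t f) g = inner ℝ f (P t g) := by
  have hback : ∀ (k : Lp ℝ 2 π) , ContinuousOn (fun s => P (t - s) k) (Icc 0 t) := fun k =>
    (hP.cont k).comp (by fun_prop) fun s hs => by simpa using hs.2
  have hcont : ContinuousOn (fun s => inner ℝ (P s f) (P (t - s) g)) (Icc 0 t) :=
    (hP.continuousOn_apply f le_rfl).inner (hback g)
  have hder : ∀ s ∈ Ico 0 t, HasDerivWithinAt (fun s => inner ℝ (P s f) (P (t - s) g))
      0 (Ici s) s := by
    intro s hs
    rw [hasDerivWithinAt_iff_tendsto_slope, Ici_sdiff_left]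
    have hmem : Ioo s t ∈ 𝓝[>] s := Ioo_mem_nhdsGT hs.2
    have hsub := tendsto_sub_self_nhdsGT s
    have hPz : ∀ k : Lp ℝ 2 π, Tendsto (fun z => P (t - z) k) (𝓝[>] s) (𝓝 (P (t - s) k)) :=
      fun k => ((hback k) s ⟨hs.1, hs.2.le⟩).tendsto.mono_left
        (nhdsWithin_le_of_mem (mem_of_superset hmem
          fun z hz => ⟨hs.1.trans hz.1.le, hz.2.le⟩))
    have h1 := (hP.tendsto_iff.2 (hP.isGenerator_apply h hs.1)).comp hsub
    have h2 := (hP.tendsto_iff.2 h').comp hsub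
    -- The operator `P_{t-z}` varies with `z` and converges only strongly; the uniform bound
    -- `‖P_{t-z}‖ ≤ 1` allows the limit to be taken in its argument as well.
    have h3 : Tendsto (fun z => P (t - z) ((z - s)⁻¹ • (P (z - s) g - g))) (𝓝[>] s)
        (𝓝 (P (t - s) g')) := by
      have h4 : Tendsto (fun z => P (t - z) ((z - s)⁻¹ • (P (z - s) g - g) - g')) (𝓝[>] s)
          (𝓝 0) := by
        refine squeeze_zero_norm' ?_ (tendsto_iff_norm_sub_tendsto_zero.1 h2)
        filter_upwards [hmem] with z hz
        exact hP.norm_apply_le (by linarith [hz.2]) _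
      have h5 := h4.add (hPz g')
      rw [zero_add] at h5
      refine h5.congr fun z => ?_
      rw [map_sub, sub_add_cancel]
    have h6 := (h1.inner (𝕜 := ℝ) (hPz g)).sub ((tendsto_const_nhds (x := P s f)).inner h3)
    rw [(hP.isGenerator_apply h hs.1).symm (hP.isGenerator_apply h' (by linarith [hs.2])),
      sub_self] at h6
    refine h6.congr' ?_
    filter_upwards [hmem] with z hz
    have hz1 : 0 ≤ z - s := by linarith [hz.1]
    have hz2 : 0 ≤ t - z := by linarith [hz.2]
    have e1 : P z f = P (z - s) (P s f) := by rw [← hP.add_apply hz1 hs.1, sub_add_cancel]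
    have e2 : P (t - s) g = P (t - z) (P (z - s) g) := by
      rw [← hP.add_apply hz2 hz1, sub_add_sub_cancel]
    simp only [Function.comp, slope_def_module]
    rw [map_smul, map_sub, ← e2, e1, real_inner_smul_left, real_inner_smul_right, inner_sub_left,
      inner_sub_right, smul_eq_mul]
    ring
  have := constant_of_has_deriv_right_zero hcont hder t (right_mem_Icc.2 ht)
  simpa [hP.zero_apply] using this

/-- The operators of the semigroup are symmetric. -/
lemma symm (hP : D.IsSemigroup P) {t : ℝ} (ht : 0 ≤ t) (f g : Lp ℝ 2 π) :
    inner ℝ (P t f) g = inner ℝ f (P t g) := by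
  have hc : IsClosed {f : Lp ℝ 2 π | inner ℝ (P t f) g = inner ℝ f (P t g)} :=
    isClosed_eq (by fun_prop) (by fun_prop)
  refine hP.dense_generator.induction (fun f ⟨_, h⟩ => ?_) hc f
  have hc : IsClosed {g : Lp ℝ 2 π | inner ℝ (P t f) g = inner ℝ f (P t g)} :=
    isClosed_eq (by fun_prop) (by fun_prop)
  exact hP.dense_generator.induction (fun g ⟨_, h'⟩ => hP.symm_of_isGenerator h h' ht) hc g

end IsSemigroup

end SymmetricForm

/-! ### Energy estimates without the spectral theorem -/

namespace SymmetricForm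

variable {E : Type*} [MeasurableSpace E] {π : Measure E} {D : SymmetricForm π}
  {P : ℝ → Lp ℝ 2 π →L[ℝ] Lp ℝ 2 π}

namespace IsSemigroup

lemma inner_apply_two_mul (hP : D.IsSemigroup P) {t : ℝ} (ht : 0 ≤ t) (f g : Lp ℝ 2 π) :
    inner ℝ (P (2 * t) f) g = inner ℝ (P t f) (P t g) := by
  rw [two_mul, hP.add_apply ht ht, hP.symm ht]

lemma inner_apply_self_nonneg (hP : D.IsSemigroup P) {t : ℝ} (ht : 0 ≤ t) (f : Lp ℝ 2 π) :
    0 ≤ inner ℝ (P t f) f := by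
  have := hP.inner_apply_two_mul (t := t / 2) (by positivity) f f
  rw [mul_div_cancel₀ t two_ne_zero] at this
  rw [this]
  exact real_inner_self_nonneg

lemma sub_apply_eq_sum (hP : D.IsSemigroup P) {h : ℝ} (hh : 0 ≤ h) (n : ℕ) (f : Lp ℝ 2 π) :
    f - P (n * h) f = ∑ k ∈ Finset.range n, P (k * h) (f - P h f) := by
  induction n with
  | zero => simp [hP.zero_apply]
  | succ n ih =>
    rw [Finset.sum_range_succ, ← ih, map_sub, ← hP.add_apply (by positivity) hh]
    push_cast
    rw [add_mul, one_mul]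
    abel

/-- Telescoping both differences with mesh `h` leaves a double sum of terms `⟨P_{(k+l)h} g, g⟩ ≥ 0`
with `g = f - P_h f`. -/
lemma inner_sub_apply_nonneg_of_nat (hP : D.IsSemigroup P) {h : ℝ} (hh : 0 ≤ h) (m n : ℕ)
    (f : Lp ℝ 2 π) : 0 ≤ inner ℝ (f - P (m * h) f) (f - P (n * h) f) := by
  rw [hP.sub_apply_eq_sum hh, hP.sub_apply_eq_sum hh, sum_inner]
  refine Finset.sum_nonneg fun k _ => ?_
  rw [inner_sum]
  refine Finset.sum_nonneg fun l _ => ?_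
  rw [← hP.symm (by positivity), ← hP.add_apply (by positivity) (by positivity)]
  exact hP.inner_apply_self_nonneg (by positivity) _

/-- The commuting operators `1 - P_s` and `1 - P_t` have a non-negative product. -/
lemma inner_sub_apply_nonneg (hP : D.IsSemigroup P) {s t : ℝ} (hs : 0 ≤ s) (ht : 0 < t)
    (f : Lp ℝ 2 π) : 0 ≤ inner ℝ (f - P s f) (f - P t f) := by
  -- The mesh `t/N` divides `t` exactly, and its multiples approximate `s`; strong continuity then
  -- passes to the limit.
  have h1 : Tendsto (fun N : ℕ => (⌊s / t * N⌋₊ : ℝ) * (t / N)) atTop (𝓝 s) := by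
    have := ((tendsto_nat_floor_mul_div_atTop (R := ℝ) (div_nonneg hs ht.le)).comp
      tendsto_natCast_atTop_atTop).mul_const t
    rw [div_mul_cancel₀ s ht.ne'] at this
    refine this.congr fun N => ?_
    simp only [Function.comp]
    ring
  have h2 : Tendsto (fun N : ℕ => P ((⌊s / t * N⌋₊ : ℝ) * (t / N)) f) atTop (𝓝 (P s f)) :=
    ((hP.cont f) s hs).tendsto.comp (tendsto_nhdsWithin_iff.2
      ⟨h1, Eventually.of_forall fun N => mem_Ici.2 (by positivity)⟩)
  refine ge_of_tendsto ((h2.const_sub f).inner (𝕜 := ℝ) (tendsto_const_nhds (x := f - P t f))) ?_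
  filter_upwards [eventually_gt_atTop 0] with N hN
  have hN' : (N : ℝ) ≠ 0 := by positivity
  have := hP.inner_sub_apply_nonneg_of_nat (h := t / N) (by positivity) ⌊s / t * N⌋₊ N f
  rwa [mul_div_cancel₀ t hN'] at this

/-- This is `D(P_t f) ≤ D(f)`. The difference is `-⟨L f, f - P_{2t} f⟩`, a limit of `s⁻¹⟨f - P_s f,
f - P_{2t} f⟩ ≥ 0`. -/
lemma form_apply_le_of_isGenerator (hP : D.IsSemigroup P) {f g : Lp ℝ 2 π}
    (h : D.IsGenerator f g) {t : ℝ} (ht : 0 ≤ t) :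
    -inner ℝ (P t g) (P t f) ≤ -inner ℝ g f := by
  rw [← hP.inner_apply_two_mul ht, hP.symm (by positivity)]
  have h1 := (hP.tendsto_iff.2 h).inner (𝕜 := ℝ) (tendsto_const_nhds (x := f - P (2 * t) f))
  have h2 : inner ℝ g (f - P (2 * t) f) ≤ 0 := by
    refine le_of_tendsto h1 ?_
    filter_upwards [self_mem_nhdsWithin] with s (hs : 0 < s)
    have := hP.inner_sub_apply_nonneg (s := 2 * t) (by positivity) hs f
    rw [real_inner_smul_left, ← neg_sub f, inner_neg_left, real_inner_comm, mul_neg]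
    have : 0 ≤ s⁻¹ * inner ℝ (f - P (2 * t) f) (f - P s f) := by positivity
    linarith
  rw [inner_sub_right] at h2
  linarith

/-- As energy decreases, `‖P_s f‖²` has slope `-2 D(P_s f) ≤ -2 D(P_t f)` for `s < t`, so it stays
below the line of slope `-2 D(P_t f)` starting at `‖f‖²`. -/
lemma two_mul_inner_le_of_isGenerator (hP : D.IsSemigroup P) {f g : Lp ℝ 2 π}
    (h : D.IsGenerator f g) {t : ℝ} (ht : 0 ≤ t) :
    ‖P t f‖ ^ 2 + 2 * t * (-inner ℝ (P t g) (P t f)) ≤ ‖f‖ ^ 2 := by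
  have h1 : ∀ s ∈ Ico 0 t, HasDerivWithinAt (fun s => ‖P s f‖ ^ 2)
      (2 * inner ℝ (P s f) (P s g)) (Ici s) s :=
    fun s hs => (hP.hasDerivWithinAt h hs.1).norm_sq
  have h2 : ∀ s ∈ Ico 0 t, HasDerivWithinAt
      (fun s => ‖f‖ ^ 2 + s * (2 * inner ℝ (P t g) (P t f))) (2 * inner ℝ (P t g) (P t f))
      (Ici s) s := fun s _ => by
    simpa using (((hasDerivAt_id s).mul_const
      (2 * inner ℝ (P t g) (P t f))).const_add (‖f‖ ^ 2)).hasDerivWithinAt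
  have := image_le_of_deriv_right_le_deriv_boundary (f := fun s => ‖P s f‖ ^ 2)
    (((hP.continuousOn_apply f le_rfl).norm).pow 2) h1
    (by simp [hP.zero_apply]) (by fun_prop) h2
    (fun s hs => by
      have := hP.form_apply_le_of_isGenerator (hP.isGenerator_apply h hs.1)
        (sub_nonneg.2 hs.2.le)
      rw [← hP.add_apply (sub_nonneg.2 hs.2.le) hs.1, ← hP.add_apply (sub_nonneg.2 hs.2.le) hs.1,
        sub_add_cancel] at this
      rw [real_inner_comm]; linarith) (right_mem_Icc.2 ht)
  linarith

/-- Regularization: `P_t f` lies in the domain of the form for `t > 0`, with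
`2 t D(P_t f) ≤ ‖f‖² - ‖P_t f‖²`. -/
lemma norm_sq_add_form_le (hP : D.IsSemigroup P) {t : ℝ} (ht : 0 < t) (f : Lp ℝ 2 π) :
    ∃ h : P t f ∈ D.domain, ‖P t f‖ ^ 2 + 2 * t * D.form ⟨P t f, h⟩ ⟨P t f, h⟩ ≤ ‖f‖ ^ 2 := by
  obtain ⟨u, hu, hlim⟩ := mem_closure_iff_seq_limit.1 (hP.dense_generator f)
  choose v hv using hu
  have hmem : ∀ n, P t (u n) ∈ D.domain := fun n => (hP.isGenerator_apply (hv n) ht.le).1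
  let w : ℕ → D.domain := fun n => ⟨P t (u n), hmem n⟩
  have hw : Tendsto (fun n => (w n : Lp ℝ 2 π)) atTop (𝓝 (P t f)) :=
    ((P t).continuous.tendsto f).comp hlim
  have hA : ∀ (x y : Lp ℝ 2 π) (h : D.IsGenerator x y) (k : D.domain), (k : Lp ℝ 2 π) = P t x →
      ‖P t x‖ ^ 2 + 2 * t * D.form k k ≤ ‖x‖ ^ 2 := by
    intro x y h k hk
    have h1 := hP.two_mul_inner_le_of_isGenerator h ht.le
    obtain ⟨hm, h2⟩ := hP.isGenerator_apply h ht.le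
    have hk' : k = ⟨P t x, hm⟩ := Subtype.ext hk
    rwa [hk', h2]
  -- The estimate `hA` applied to `u m - u n` controls the energy of `w m - w n` by `‖u m - u n‖² /
  -- (2t)`; closedness of the form then puts the limit in the domain.
  have hcauchy : ∀ ε > 0, ∃ N, ∀ m ≥ N, ∀ n ≥ N, D.form (w m - w n) (w m - w n) < ε := by
    intro ε hε
    obtain ⟨N, hN⟩ := Metric.cauchySeq_iff.1 hlim.cauchySeq (Real.sqrt (2 * t * ε))
      (by positivity)
    refine ⟨N, fun m hm n hn => ?_⟩
    have h1 := hA (u m - u n) _ ((hv m).sub (hv n)) (w m - w n) (by simp [w])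
    have h2 := hN m hm n hn
    rw [dist_eq_norm, Real.lt_sqrt (norm_nonneg _)] at h2
    have h3 : 0 ≤ ‖P t (u m - u n)‖ ^ 2 := by positivity
    have h4 : 2 * t * D.form (w m - w n) (w m - w n) < 2 * t * ε := by linarith
    exact lt_of_mul_lt_mul_left h4 (by positivity)
  obtain ⟨hf, hconv⟩ := D.closed w (P t f) hw hcauchy
  refine ⟨hf, ?_⟩
  set k : D.domain := ⟨P t f, hf⟩
  have hcross : Tendsto (fun n => D.form k (w n - k)) atTop (𝓝 0) := by
    have h1 : Tendsto (fun n => Real.sqrt (D.form k k * D.form (w n - k) (w n - k))) atTop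
        (𝓝 0) := by
      have := (hconv.const_mul (D.form k k)).sqrt
      simpa using this
    refine squeeze_zero_norm (fun n => ?_) h1
    exact Real.abs_le_sqrt (form_sq_le k (w n - k))
  have hform : Tendsto (fun n => D.form (w n) (w n)) atTop (𝓝 (D.form k k)) := by
    have h1 := ((hcross.const_mul 2).add hconv).const_add (D.form k k)
    simp only [mul_zero, add_zero] at h1
    refine h1.congr fun n => ?_
    simp only [map_sub, LinearMap.sub_apply, D.symm (w n) k]
    ring
  refine le_of_tendsto_of_tendsto ((hw.norm.pow 2).add (hform.const_mul (2 * t)))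
    (hlim.norm.pow 2) (Eventually.of_forall fun n => ?_)
  exact hA _ _ (hv n) (w n) rfl

/-- `⟨f - P_ε f, f⟩ ≤ ε D(f)` on the domain of the form. -/
lemma inner_sub_apply_le_form (hP : D.IsSemigroup P) {ε : ℝ} (hε : 0 < ε) (f : D.domain) :
    inner ℝ ((f : Lp ℝ 2 π) - P ε f) f ≤ ε * D.form f f := by
  obtain ⟨hA, hgen⟩ := hP.isGenerator_average f hε
  set A : D.domain := ⟨_, hA⟩
  -- With `A` the time average of `P_s f` over `[0, ε]`, this is an average of the non-negative
  -- products `⟨f - P_ε f, f - P_s f⟩`.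
  have hpos : 0 ≤ inner ℝ ((f : Lp ℝ 2 π) - P ε f) (f - A) := by
    have h1 : ∫ s in (0 : ℝ)..ε, inner ℝ ((f : Lp ℝ 2 π) - P ε f) (f - P (max s 0) f) =
        ε * inner ℝ ((f : Lp ℝ 2 π) - P ε f) (f - A) := by
      have hc := hP.continuous_max f
      have h2 := (innerSL ℝ ((f : Lp ℝ 2 π) - P ε f)).intervalIntegral_comp_comm
        (((continuous_const (y := (f : Lp ℝ 2 π))).sub hc).intervalIntegrable (μ := volume) 0 ε)
      simp only [innerSL_apply_apply, Pi.sub_apply] at h2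
      rw [h2, intervalIntegral.integral_sub (by simp) (hc.intervalIntegrable _ _),
        intervalIntegral.integral_const, ← real_inner_smul_right]
      congr 1
      simp [A, smul_sub, smul_smul, hε.ne']
    have h3 : 0 ≤ ε * inner ℝ ((f : Lp ℝ 2 π) - P ε f) (f - A) := by
      rw [← h1]
      refine intervalIntegral.integral_nonneg hε.le fun s hs => ?_
      rw [real_inner_comm]
      exact hP.inner_sub_apply_nonneg (le_max_right _ _) hε _
    exact nonneg_of_mul_nonneg_right h3 hε
  have hAh : ∀ h : D.domain, D.form A h = ε⁻¹ * inner ℝ ((f : Lp ℝ 2 π) - P ε f) h := by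
    intro h
    rw [hgen, real_inner_smul_left, ← neg_sub (f : Lp ℝ 2 π), inner_neg_left]
    ring
  -- The form is represented by `D(A, h) = ε⁻¹⟨f - P_ε f, h⟩`, so the goal is `D(A, f) ≤ D(f)`.
  -- Cauchy–Schwarz gives `D(A, f)² ≤ D(A) D(f) ≤ D(A, f) D(f)`, and one factor cancels.
  have h1 : D.form A A ≤ D.form A f := by
    rw [hAh, hAh]
    rw [inner_sub_right] at hpos
    gcongr
    linarith
  have h2 := form_sq_le A f
  have h3 := D.nonneg A
  have h4 : D.form A f ≤ D.form f f := by
    rcases (h3.trans h1).eq_or_lt with h0 | h0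
    · rw [← h0]; exact D.nonneg f
    · have := mul_le_mul_of_nonneg_right h1 (D.nonneg f)
      refine le_of_mul_le_mul_left ?_ h0
      nlinarith
  rw [hAh, inv_mul_le_iff₀ hε] at h4
  exact h4

/-- Take `ε = 2t` in the preceding bound: by symmetry `⟨P_{2t} f, f⟩ = ‖P_t f‖²`. -/
lemma norm_sq_le_add_form (hP : D.IsSemigroup P) {t : ℝ} (ht : 0 < t) (f : D.domain) :
    ‖(f : Lp ℝ 2 π)‖ ^ 2 ≤ ‖P t f‖ ^ 2 + 2 * t * D.form f f := by
  have := hP.inner_sub_apply_le_form (ε := 2 * t) (by positivity) f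
  rw [inner_sub_left, hP.inner_apply_two_mul ht.le, real_inner_self_eq_norm_sq,
    real_inner_self_eq_norm_sq] at this
  linarith

/-! ### Conservation of the mean, and the two estimates for variances -/

variable [IsProbabilityMeasure π]

/-- Cauchy–Schwarz gives `D(1, k)² ≤ D(1) D(k) = 0`, so `L 1 = 0`. -/
lemma _root_.SymmetricForm.IsConservative.isGenerator (hD : D.IsConservative) :
    D.IsGenerator (Lp.const 2 π (1 : ℝ)) 0 := by
  obtain ⟨h, h0⟩ := hD
  refine ⟨h, fun k => ?_⟩
  have := form_sq_le ⟨_, h⟩ k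
  rw [h0, zero_mul] at this
  simpa using pow_eq_zero_iff two_ne_zero |>.1 (le_antisymm this (sq_nonneg _))

lemma apply_const_one (hP : D.IsSemigroup P) (hD : D.IsConservative) {t : ℝ} (ht : 0 ≤ t) :
    P t (Lp.const 2 π (1 : ℝ)) = Lp.const 2 π (1 : ℝ) := by
  have := constant_of_has_deriv_right_zero (hP.continuousOn_apply (Lp.const 2 π (1 : ℝ)) le_rfl)
    (fun s hs => by simpa using hP.hasDerivWithinAt hD.isGenerator hs.1) t (right_mem_Icc.2 ht)
  simpa [hP.zero_apply] using this

lemma _root_.MeasureTheory.Lp.inner_const_one (f : Lp ℝ 2 π) :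
    inner ℝ (Lp.const 2 π (1 : ℝ)) f = ∫ x, f x ∂π := by
  rw [L2.inner_def]
  simp

lemma _root_.MeasureTheory.Lp.variance_eq (f : Lp ℝ 2 π) :
    variance f π = ‖f‖ ^ 2 - (∫ x, f x ∂π) ^ 2 := by
  rw [variance_eq_sub (Lp.memLp f), ← real_inner_self_eq_norm_sq, L2.inner_def]
  congr 1
  refine integral_congr_ae (Eventually.of_forall fun x => ?_)
  simp [sq]

lemma integral_apply (hP : D.IsSemigroup P) (hD : D.IsConservative) {t : ℝ} (ht : 0 ≤ t)
    (f : Lp ℝ 2 π) : ∫ x, P t f x ∂π = ∫ x, f x ∂π := by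
  rw [← Lp.inner_const_one, ← Lp.inner_const_one, ← hP.symm ht, hP.apply_const_one hD ht]

lemma variance_add_form_le (hP : D.IsSemigroup P) (hD : D.IsConservative) {t : ℝ} (ht : 0 < t)
    (f : Lp ℝ 2 π) : ∃ h : P t f ∈ D.domain,
      variance (P t f) π + 2 * t * D.form ⟨P t f, h⟩ ⟨P t f, h⟩ ≤ variance f π := by
  obtain ⟨h, hle⟩ := hP.norm_sq_add_form_le ht f
  refine ⟨h, ?_⟩
  rw [Lp.variance_eq, Lp.variance_eq, hP.integral_apply hD ht.le]
  linarith

lemma variance_le_add_form (hP : D.IsSemigroup P) (hD : D.IsConservative) {t : ℝ} (ht : 0 < t)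
    (f : D.domain) : variance (f : Lp ℝ 2 π) π ≤ variance (P t f) π + 2 * t * D.form f f := by
  have := hP.norm_sq_le_add_form ht f
  rw [Lp.variance_eq, Lp.variance_eq, hP.integral_apply hD ht.le]
  linarith

end IsSemigroup

end SymmetricForm

/-! ### Two real-variable inequalities -/

/-- A bounded function with `φ(t)^p ≤ K φ(t/2) / t` decays like `t^{-(q-1)}`. -/
lemma le_div_rpow_of_rpow_le_half {p q : ℝ} (hpq : p.HolderConjugate q) {φ : ℝ → ℝ} {B K : ℝ}
    (h0 : ∀ t, 0 < t → 0 ≤ φ t) (hB : ∀ t, 0 < t → φ t ≤ B) (hK : 0 ≤ K)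
    (h : ∀ t, 0 < t → φ t ^ p ≤ K * φ (t / 2) / t) {t : ℝ} (ht : 0 < t) :
    φ t ≤ (2 ^ (q - 1) * K) ^ (q - 1) / t ^ (q - 1) := by
  have hp := hpq.pos
  have hq1 : 0 < q - 1 := hpq.symm.sub_one_pos
  have hp1 : 0 < p - 1 := hpq.sub_one_pos
  have hpq1 : (q - 1) * p = q := by linarith [hpq.mul_eq_add]
  have hpq2 : (p - 1) * (q - 1) = 1 := by linarith [hpq.mul_eq_add]
  set L := 2 ^ (q - 1) * K with hL
  have hL0 : 0 ≤ L := by positivity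
  -- This rescaling makes the recursion scale-free: `M(s)^p ≤ L M(s/2)`. The factor `2^(q-1)` in `L`
  -- pays for replacing `s` by `s/2`.
  let M : ℝ → ℝ := fun s => s ^ (q - 1) * φ s
  have hM0 : ∀ s, 0 < s → 0 ≤ M s := fun s hs => mul_nonneg (by positivity) (h0 s hs)
  have hM : ∀ s, 0 < s → M s ^ p ≤ L * M (s / 2) := by
    intro s hs
    have e1 : M s ^ p = s ^ q * φ s ^ p := by
      rw [Real.mul_rpow (by positivity) (h0 s hs), ← Real.rpow_mul hs.le, hpq1]
    have e2 : L * M (s / 2) = s ^ q * (K * φ (s / 2) / s) := by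
      have : s ^ q = s ^ (q - 1) * s := by rw [← Real.rpow_add_one hs.ne', sub_add_cancel]
      simp only [M, hL]
      rw [Real.div_rpow hs.le (by norm_num), this]
      field_simp
    rw [e1, e2]
    exact mul_le_mul_of_nonneg_left (h s hs) (by positivity)
  -- Finiteness of the supremum `S` is where boundedness of `φ` enters. It allows cancellation in
  -- `S^p ≤ L S`, whence `S ≤ L^(q-1)` since `(p-1)(q-1) = 1`.
  have hbdd : BddAbove (M '' Ioc 0 t) := by
    refine ⟨t ^ (q - 1) * B, ?_⟩
    rintro _ ⟨s, hs, rfl⟩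
    exact mul_le_mul (Real.rpow_le_rpow hs.1.le hs.2 hq1.le) (hB s hs.1) (h0 s hs.1)
      (by positivity)
  set S := sSup (M '' Ioc 0 t)
  have hle : ∀ s ∈ Ioc 0 t, M s ≤ S := fun s hs => le_csSup hbdd (mem_image_of_mem M hs)
  have hS0 : 0 ≤ S := (hM0 t ht).trans (hle t ⟨ht, le_rfl⟩)
  have hSp : S ≤ (L * S) ^ p⁻¹ := by
    refine csSup_le ⟨M t, mem_image_of_mem M ⟨ht, le_rfl⟩⟩ ?_
    rintro _ ⟨s, hs, rfl⟩
    rw [Real.le_rpow_inv_iff_of_pos (hM0 s hs.1) (by positivity) hp]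
    exact (hM s hs.1).trans (mul_le_mul_of_nonneg_left
      (hle _ ⟨half_pos hs.1, (half_le_self hs.1.le).trans hs.2⟩) hL0)
  have hSL : S ≤ L ^ (q - 1) := by
    rcases hS0.eq_or_lt with h1 | h1
    · rw [← h1]; positivity
    · rw [Real.le_rpow_inv_iff_of_pos hS0 (by positivity) hp] at hSp
      have e : S ^ p = S ^ (p - 1) * S := by rw [← Real.rpow_add_one h1.ne', sub_add_cancel]
      rw [e] at hSp
      have h2 := Real.rpow_le_rpow (by positivity) (le_of_mul_le_mul_right hSp h1) hq1.le
      rwa [← Real.rpow_mul hS0, hpq2, Real.rpow_one] at h2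
  rw [le_div_iff₀ (by positivity), mul_comm]
  exact (hle t ⟨ht, le_rfl⟩).trans hSL

/-- Optimization in `t` of the bound `C v / t^{q-1} + 2 t d`. -/
lemma le_mul_rpow_of_forall_le_add {p q : ℝ} (hpq : p.HolderConjugate q) {X C v d : ℝ}
    (hv : 0 ≤ v) (hd : 0 ≤ d) (h : ∀ t, 0 < t → X ≤ C * v / t ^ (q - 1) + 2 * t * d) :
    X ≤ (C + 2) * d ^ (1 / p) * v ^ (1 / q) := by
  have hp := hpq.pos
  have hq := hpq.symm.pos
  have hq1 : 0 < q - 1 := hpq.symm.sub_one_pos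
  -- In the degenerate cases the optimal time escapes: `t → ∞` if `d = 0`, and `t → 0` if `v = 0`.
  rcases hd.eq_or_lt with rfl | hd'
  · rw [Real.zero_rpow (by positivity)]
    have h1 : Tendsto (fun t : ℝ => C * v / t ^ (q - 1) + 2 * t * 0) atTop (𝓝 0) := by
      simpa using (tendsto_rpow_atTop hq1).const_div_atTop (C * v)
    have := ge_of_tendsto h1 ((eventually_gt_atTop 0).mono h)
    simpa using this
  rcases hv.eq_or_lt with rfl | hv'
  · rw [Real.zero_rpow (by positivity)]
    have h1 : Tendsto (fun t : ℝ => C * 0 / t ^ (q - 1) + 2 * t * d) (𝓝[>] 0) (𝓝 0) := by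
      have : Tendsto (fun t : ℝ => 2 * t * d) (𝓝 0) (𝓝 (2 * 0 * d)) :=
        Continuous.tendsto (by fun_prop) 0
      simpa using this.mono_left nhdsWithin_le_nhds
    have := ge_of_tendsto h1 (eventually_nhdsWithin_of_forall fun t ht => h t ht)
    simpa using this
  have hinv : 1 / p = 1 - 1 / q := by
    have := hpq.inv_add_inv_eq_one
    simp only [one_div]; linarith
  -- At this `t` both `v / t^(q-1)` and `t d` equal `d^(1/p) v^(1/q)`.
  have h1 := h ((v / d) ^ (1 / q)) (by positivity)
  have e1 : (v / d) ^ (1 / q) * d = d ^ (1 / p) * v ^ (1 / q) := by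
    rw [Real.div_rpow hv hd, hinv, Real.rpow_sub hd', Real.rpow_one]
    ring
  have e2 : v / ((v / d) ^ (1 / q)) ^ (q - 1) = d ^ (1 / p) * v ^ (1 / q) := by
    have : 1 / q * (q - 1) = 1 - 1 / q := by field_simp
    rw [← Real.rpow_mul (by positivity), this, ← hinv, Real.div_rpow hv hd]
    have e3 : v ^ (1 / q) = v / v ^ (1 / p) := by
      rw [hinv, Real.rpow_sub hv', Real.rpow_one]
      field_simp
    rw [e3]
    field_simp
  rw [mul_div_assoc, e2, mul_assoc 2, e1] at h1
  linarith

/-! ### Functional inequalities and decay of the variance -/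

namespace SymmetricForm

variable {E : Type*} [MeasurableSpace E] {π : Measure E} [IsProbabilityMeasure π]
  {D : SymmetricForm π} {P : ℝ → Lp ℝ 2 π →L[ℝ] Lp ℝ 2 π}

namespace IsSemigroup

lemma variance_apply_le (hP : D.IsSemigroup P) (hD : D.IsConservative) {t : ℝ} (ht : 0 ≤ t)
    (f : Lp ℝ 2 π) : variance (P t f) π ≤ variance f π := by
  rw [Lp.variance_eq, Lp.variance_eq, hP.integral_apply hD ht]
  gcongr
  exact hP.norm_apply_le ht f

theorem algebraicDecay_of_liggettStroock (hP : D.IsSemigroup P) (hD : D.IsConservative)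
    {p q : ℝ} (hpq : p.HolderConjugate q) {V : Lp ℝ 2 π → ℝ≥0∞}
    (hV : ∀ t : ℝ, 0 ≤ t → ∀ f, V (P t f) ≤ V f) {C : ℝ} (hC : 0 < C)
    (h : D.LiggettStroock V p q C) :
    AlgebraicDecay P V q ((2 ^ (q - 1)) ^ (q - 1) * C ^ q) := by
  intro f hf t ht
  have hp := hpq.pos
  have hq := hpq.symm.pos
  have hpq1 : p * (q - 1) = q := by linarith [hpq.mul_eq_add]
  have hpq2 : (p - 1) * (q - 1) = 1 := by linarith [hpq.mul_eq_add]
  set v := (V f).toReal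
  have hv : 0 ≤ v := ENNReal.toReal_nonneg
  have key : ∀ s, 0 < s → variance (P s f) π ^ p ≤
      C ^ p * v ^ (p - 1) * variance (P (s / 2) f) π / s := by
    intro s hs
    have hs2 : 0 < s / 2 := by positivity
    -- Running the semigroup for time `s/2` from `P_{s/2} f` gives `s D(P_s f) ≤ Var(P_{s/2} f)`.
    obtain ⟨hmem, hle⟩ := hP.variance_add_form_le hD hs2 (P (s / 2) f)
    have hsemi : P (s / 2) (P (s / 2) f) = P s f := by
      rw [← hP.add_apply hs2.le hs2.le, add_halves]
    have hVs : V (P s f) ≤ V f := hV s hs.le f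
    have hLS := h ⟨_, hmem⟩ (by simp only [hsemi]; exact ne_top_of_le_ne_top hf hVs)
    set d := D.form ⟨_, hmem⟩ ⟨_, hmem⟩
    have hd : 0 ≤ d := D.nonneg _
    simp only [hsemi] at hLS hle
    have h1 : variance (P s f) π ≤ C * d ^ (1 / p) * v ^ (1 / q) := by
      refine hLS.trans ?_
      gcongr
      exact ENNReal.toReal_mono hf hVs
    have h2 := Real.rpow_le_rpow (variance_nonneg _ _) h1 hp.le
    have e : (C * d ^ (1 / p) * v ^ (1 / q)) ^ p = C ^ p * v ^ (p - 1) * d := by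
      have : 1 / q * p = p - 1 := by
        field_simp; linarith
      rw [Real.mul_rpow (by positivity) (by positivity), Real.mul_rpow hC.le (by positivity),
        ← Real.rpow_mul hd, ← Real.rpow_mul hv, this, one_div_mul_cancel hp.ne', Real.rpow_one]
      ring
    rw [e] at h2
    refine h2.trans ?_
    rw [mul_div_assoc]
    gcongr
    rw [le_div_iff₀ hs]
    have := variance_nonneg (P s f) π
    linarith
  refine (le_div_rpow_of_rpow_le_half hpq (φ := fun s => variance (P s f) π)
    (fun s _ => variance_nonneg _ _) (fun s hs => hP.variance_apply_le hD hs.le f)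
    (by positivity) key ht).trans_eq ?_
  rw [Real.mul_rpow (by positivity) (by positivity), Real.mul_rpow (by positivity)
    (by positivity), ← Real.rpow_mul hC.le, ← Real.rpow_mul hv, hpq1, hpq2, Real.rpow_one]
  ring

theorem liggettStroock_of_algebraicDecay (hP : D.IsSemigroup P) (hD : D.IsConservative)
    {p q : ℝ} (hpq : p.HolderConjugate q) {V : Lp ℝ 2 π → ℝ≥0∞} {C : ℝ}
    (h : AlgebraicDecay P V q C) : D.LiggettStroock V p q (C + 2) := by
  intro f hf
  refine le_mul_rpow_of_forall_le_add hpq ENNReal.toReal_nonneg (D.nonneg f) fun t ht => ?_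
  have h1 := hP.variance_le_add_form hD ht f
  have h2 := h f hf t ht
  linarith

theorem poincare_iff_exponentialDecay (hP : D.IsSemigroup P) (hD : D.IsConservative) {c : ℝ}
    (hc : 0 < c) : D.Poincare c⁻¹ ↔ ExponentialDecay P c := by
  constructor
  · intro h f t ht
    rcases ht.eq_or_lt with rfl | ht
    · simp [hP.zero_apply]
    have hstep : ∀ s, 0 < s → ∀ g : Lp ℝ 2 π,
        variance (P s g) π * (1 + 2 * c * s) ≤ variance g π := by
      intro s hs g
      obtain ⟨hmem, hle⟩ := hP.variance_add_form_le hD hs g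
      have h1 := h ⟨_, hmem⟩
      rw [inv_mul_eq_div, le_div_iff₀ hc] at h1
      have := mul_le_mul_of_nonneg_left h1 (by positivity : 0 ≤ 2 * s)
      linarith
    have hiter : ∀ s, 0 < s → ∀ n : ℕ,
        variance (P (n * s) f) π * (1 + 2 * c * s) ^ n ≤ variance f π := by
      intro s hs n
      induction n with
      | zero => simp [hP.zero_apply]
      | succ n ih =>
        refine le_trans ?_ ih
        have h1 := hstep s hs (P (n * s) f)
        rw [← hP.add_apply hs.le (by positivity)] at h1
        have e : ((n + 1 : ℕ) : ℝ) * s = s + n * s := by push_cast; ring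
        rw [e, pow_succ', ← mul_assoc]
        exact mul_le_mul_of_nonneg_right h1 (by positivity)
    -- With `n` steps of length `t/n`, the factor `(1 + 2ct/n)^n` tends to `exp(2ct)`, which
    -- recovers the sharp rate.
    have hlim := (Real.tendsto_one_add_div_pow_exp (2 * c * t)).const_mul (variance (P t f) π)
    have hfin : variance (P t f) π * Real.exp (2 * c * t) ≤ variance f π := by
      refine le_of_tendsto hlim ?_
      filter_upwards [eventually_gt_atTop 0] with n hn
      have hn' : (n : ℝ) ≠ 0 := by positivity
      have := hiter (t / n) (by positivity) n
      rwa [mul_div_cancel₀ t hn', ← mul_div_assoc] at this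
    rw [neg_mul, neg_mul, Real.exp_neg, ← div_eq_mul_inv, le_div_iff₀ (Real.exp_pos _)]
    exact hfin
  · intro h f
    rw [inv_mul_eq_div, le_div_iff₀ hc]
    -- Combining exponential decay with `Var(f) - Var(P_t f) ≤ 2t D(f)`, dividing by `t` and letting
    -- `t → 0` gives `2c Var(f) ≤ 2 D(f)`.
    have hder : HasDerivAt (fun t : ℝ => Real.exp (-2 * c * t)) (-2 * c) 0 := by
      have := ((hasDerivAt_id (0 : ℝ)).const_mul (-2 * c)).exp
      simpa using this
    have h1 := hder.tendsto_slope.mono_left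
      (nhdsWithin_mono 0 fun x (hx : x ∈ Ioi 0) => ne_of_gt hx)
    have h2 := h1.const_mul (-variance (f : Lp ℝ 2 π) π)
    have h3 : -variance (f : Lp ℝ 2 π) π * (-2 * c) ≤ 2 * D.form f f := by
      refine le_of_tendsto h2 ?_
      filter_upwards [self_mem_nhdsWithin] with t (ht : 0 < t)
      have h4 := hP.variance_le_add_form hD ht f
      have h5 := h f t ht.le
      rw [slope_def_field, mul_zero, Real.exp_zero, sub_zero, ← mul_div_assoc, div_le_iff₀ ht]
      linarith
    linarith

end IsSemigroup

/-! ### The spectral gap -/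

/-- A function of positive variance yields a competitor for the spectral gap. -/
lemma spectralGap_mul_variance_le (hD : D.IsConservative) (f : D.domain)
    (hf : 0 < variance (f : Lp ℝ 2 π) π) :
    D.spectralGap ≤ ENNReal.ofReal (D.form f f / variance (f : Lp ℝ 2 π) π) := by
  obtain ⟨h1, h10⟩ := hD
  set o : D.domain := ⟨_, h1⟩
  set σ := variance (f : Lp ℝ 2 π) π
  set m := ∫ x, (f : Lp ℝ 2 π) x ∂π
  have hoo : inner ℝ (o : Lp ℝ 2 π) (o : Lp ℝ 2 π) = 1 := by
    rw [Lp.inner_const_one]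
    simp [o]
  have hof : inner ℝ (o : Lp ℝ 2 π) (f : Lp ℝ 2 π) = m := Lp.inner_const_one _
  -- The centred and normalized `f`; subtracting a constant leaves the energy unchanged because
  -- `D(1, ·) = 0`.
  set g : D.domain := (Real.sqrt σ)⁻¹ • (f - m • o)
  have hg : (g : Lp ℝ 2 π) = (Real.sqrt σ)⁻¹ • ((f : Lp ℝ 2 π) - m • (o : Lp ℝ 2 π)) := rfl
  have hg0 : ∫ x, (g : Lp ℝ 2 π) x ∂π = 0 := by
    rw [← Lp.inner_const_one, hg, real_inner_smul_right, inner_sub_right, real_inner_smul_right]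
    change _ * (inner ℝ (o : Lp ℝ 2 π) (f : Lp ℝ 2 π) - m * inner ℝ (o : Lp ℝ 2 π) o) = 0
    rw [hoo, hof]
    ring
  have hσ : σ = ‖(f : Lp ℝ 2 π)‖ ^ 2 - m ^ 2 := Lp.variance_eq _
  have hg1 : ‖(g : Lp ℝ 2 π)‖ = 1 := by
    have : ‖(g : Lp ℝ 2 π)‖ ^ 2 = 1 := by
      rw [hg, norm_smul, mul_pow, norm_sub_sq_real, real_inner_smul_right, real_inner_comm, hof,
        norm_smul, mul_pow, ← real_inner_self_eq_norm_sq (o : Lp ℝ 2 π), hoo, norm_inv, inv_pow,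
        Real.norm_eq_abs, sq_abs, Real.sq_sqrt hf.le, Real.norm_eq_abs, sq_abs,
        inv_mul_eq_one₀ hf.ne', hσ]
      ring
    exact (pow_eq_one_iff_of_nonneg (norm_nonneg _) two_ne_zero).1 this
  have hzero : ∀ k, D.form o k = 0 := by
    intro k
    have := form_sq_le o k
    rw [h10, zero_mul] at this
    exact pow_eq_zero_iff two_ne_zero |>.1 (le_antisymm this (sq_nonneg _))
  have hgg : D.form g g = D.form f f / σ := by
    have hs := Real.mul_self_sqrt hf.le
    simp only [g, map_smul, map_sub, LinearMap.smul_apply, LinearMap.sub_apply, hzero,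
      D.symm f o, smul_eq_mul, mul_zero, sub_zero]
    rw [div_eq_inv_mul, ← mul_assoc, ← mul_inv, hs]
  refine (iInf₂_le g hg0).trans ((iInf_le _ hg1).trans_eq ?_)
  rw [hgg]

lemma spectralGap_pos_of_poincare {C : ℝ} (hC : 0 < C) (h : D.Poincare C) :
    0 < D.spectralGap := by
  refine lt_of_lt_of_le (ENNReal.ofReal_pos.2 (inv_pos.2 hC)) ?_
  refine le_iInf fun f => le_iInf fun h0 => le_iInf fun h1 => ENNReal.ofReal_le_ofReal ?_
  have := h f
  rw [Lp.variance_eq, h0, h1] at this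
  rw [inv_le_iff_one_le_mul₀' hC]
  simpa using this

lemma poincare_of_spectralGap (hD : D.IsConservative) (h0 : 0 < D.spectralGap)
    (htop : D.spectralGap ≠ ∞) : D.Poincare D.spectralGap.toReal⁻¹ := by
  intro f
  have hpos : 0 < D.spectralGap.toReal := ENNReal.toReal_pos h0.ne' htop
  rw [inv_mul_eq_div, le_div_iff₀ hpos]
  rcases (variance_nonneg (f : Lp ℝ 2 π) π).eq_or_lt with hf | hf
  · rw [← hf, zero_mul]; exact D.nonneg f
  · have := ENNReal.toReal_le_of_le_ofReal (div_nonneg (D.nonneg f) hf.le)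
      (spectralGap_mul_variance_le hD f hf)
    rw [le_div_iff₀ hf] at this
    linarith

lemma poincare_of_spectralGap_eq_top (hD : D.IsConservative) (htop : D.spectralGap = ∞) (C : ℝ)
    (hC : 0 < C) : D.Poincare C := by
  intro f
  rcases (variance_nonneg (f : Lp ℝ 2 π) π).eq_or_lt with hf | hf
  · rw [← hf]; exact mul_nonneg hC.le (D.nonneg f)
  · have := spectralGap_mul_variance_le hD f hf
    rw [htop] at this
    exact absurd this (by simp)

theorem IsSemigroup.exists_poincare_iff (hP : D.IsSemigroup P) (hD : D.IsConservative) :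
    (∃ C : ℝ, 0 < C ∧ D.Poincare C) ↔
      0 < D.spectralGap ∧ ExponentialDecay P D.spectralGap.toReal := by
  constructor
  · rintro ⟨C, hC, h⟩
    have h0 := spectralGap_pos_of_poincare hC h
    refine ⟨h0, ?_⟩
    by_cases htop : D.spectralGap = ∞
    · intro f t ht
      -- Here `toReal` sends `∞` to `0`, so the claim is only that the variance does not increase.
      simpa [htop] using hP.variance_apply_le hD ht f
    · exact (hP.poincare_iff_exponentialDecay hD (ENNReal.toReal_pos h0.ne' htop)).1
        (poincare_of_spectralGap hD h0 htop)
  · rintro ⟨h0, -⟩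
    by_cases htop : D.spectralGap = ∞
    · exact ⟨1, one_pos, poincare_of_spectralGap_eq_top hD htop 1 one_pos⟩
    · exact ⟨_, inv_pos.2 (ENNReal.toReal_pos h0.ne' htop), poincare_of_spectralGap hD h0 htop⟩

end SymmetricForm

/-! ### Markovian forms: invariance of `{0 ≤ g ≤ 1}` and positivity -/

lemma MeasureTheory.Lp.real_smul_nonneg {E : Type*} [MeasurableSpace E] {π : Measure E}
    {c : ℝ} (hc : 0 ≤ c) {f : Lp ℝ 2 π} (hf : 0 ≤ f) : 0 ≤ c • f := by
  rw [← Lp.coeFn_nonneg] at hf ⊢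
  filter_upwards [Lp.coeFn_smul c f, hf] with x h1 h2
  rw [h1]
  exact mul_nonneg hc h2

namespace SymmetricForm

variable {E : Type*} [MeasurableSpace E] {π : Measure E} [IsProbabilityMeasure π]
  {D : SymmetricForm π} {P : ℝ → Lp ℝ 2 π →L[ℝ] Lp ℝ 2 π}

/-- The unit contraction `(f ∨ 0) ∧ 1`. -/
noncomputable def unitContraction (f : Lp ℝ 2 π) : Lp ℝ 2 π := (f ⊔ 0) ⊓ Lp.const 2 π (1 : ℝ)

lemma coeFn_unitContraction (f : Lp ℝ 2 π) :
    unitContraction f =ᵐ[π] fun x => min (max (f x) 0) 1 := by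
  filter_upwards [Lp.coeFn_inf (f ⊔ 0) (Lp.const 2 π (1 : ℝ)), Lp.coeFn_sup f 0] with x h1 h2
  simp [unitContraction, h1, h2]

lemma continuous_unitContraction : Continuous (unitContraction (π := π)) :=
  (continuous_id.sup continuous_const).inf continuous_const

/-- The unit contraction is the nearest-point projection onto `{0 ≤ g ≤ 1}`, and such a projection
is constant along the ray from the projected point through `f`. -/
lemma unitContraction_add_smul_sub (f : Lp ℝ 2 π) {s : ℝ} (hs : 0 ≤ s) :
    unitContraction (unitContraction f + s • (f - unitContraction f)) = unitContraction f := by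
  apply Lp.ext
  filter_upwards [coeFn_unitContraction f,
    coeFn_unitContraction (unitContraction f + s • (f - unitContraction f)),
    Lp.coeFn_add (unitContraction f) (s • (f - unitContraction f)),
    Lp.coeFn_smul s (f - unitContraction f), Lp.coeFn_sub f (unitContraction f)]
    with x h1 h2 h3 h4 h5
  rw [h2, h3, Pi.add_apply, h4, Pi.smul_apply, h5, Pi.sub_apply, h1, smul_eq_mul]
  rcases le_total (f x) 0 with h | h
  · rw [max_eq_right h, min_eq_left zero_le_one]
    have : s * (f x - 0) ≤ 0 := mul_nonpos_of_nonneg_of_nonpos hs (by linarith)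
    rw [zero_add, max_eq_right this, min_eq_left zero_le_one]
  · rw [max_eq_left h]
    rcases le_total (f x) 1 with h' | h'
    · rw [min_eq_left h', sub_self, mul_zero, add_zero, max_eq_left h, min_eq_left h']
    · rw [min_eq_right h']
      have : 0 ≤ s * (f x - 1) := mul_nonneg hs (by linarith)
      rw [max_eq_left (by linarith), min_eq_right (by linarith)]

lemma norm_sub_unitContraction_le (f g : Lp ℝ 2 π) :
    ‖f - unitContraction f‖ ≤ ‖f - unitContraction g‖ := by
  apply Lp.norm_le_norm_of_ae_le
  filter_upwards [coeFn_unitContraction f, coeFn_unitContraction g,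
    Lp.coeFn_sub f (unitContraction f), Lp.coeFn_sub f (unitContraction g)] with x h1 h2 h3 h4
  rw [h3, h4, Pi.sub_apply, Pi.sub_apply, h1, h2, Real.norm_eq_abs, Real.norm_eq_abs]
  grind

lemma unitContraction_eq_self {f : Lp ℝ 2 π} (h0 : 0 ≤ f) (h1 : f ≤ Lp.const 2 π (1 : ℝ)) :
    unitContraction f = f := by
  rw [unitContraction, sup_eq_left.2 h0, inf_eq_left.2 h1]

/-- Let `u` be the contraction of `f` and `w = f - u`. All `u + s w` with `s > 0` contract to `u`,
so `D(u) ≤ D(u + s w)`; dividing by `s` and letting `s → 0` gives `D(u, w) ≥ 0`, and `D(f, w) = D(u,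
w) + D(w)`. -/
lemma IsMarkovian.form_sub_nonneg (hM : D.IsMarkovian) (f : D.domain) :
    ∃ h : (f : Lp ℝ 2 π) - unitContraction f ∈ D.domain, 0 ≤ D.form f ⟨_, h⟩ := by
  obtain ⟨hu, -⟩ := hM f
  set u : D.domain := ⟨unitContraction f, hu⟩
  refine ⟨(f - u).2, ?_⟩
  change 0 ≤ D.form f (f - u)
  set w := f - u with hw
  have h1 : ∀ s : ℝ, 0 < s → 0 ≤ 2 * D.form u w + s * D.form w w := by
    intro s hs
    obtain ⟨h, hle⟩ := hM (u + s • w)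
    have e : (⟨_, h⟩ : D.domain) = u := Subtype.ext (unitContraction_add_smul_sub _ hs.le)
    rw [e] at hle
    simp only [map_add, map_smul, LinearMap.add_apply, LinearMap.smul_apply, smul_eq_mul,
      D.symm w u] at hle
    refine nonneg_of_mul_nonneg_right ?_ hs
    linarith
  have h2 : Tendsto (fun s => 2 * D.form u w + s * D.form w w) (𝓝[>] 0)
      (𝓝 (2 * D.form u w + 0 * D.form w w)) :=
    (Continuous.tendsto (by fun_prop) 0).mono_left nhdsWithin_le_nhds
  have h3 := ge_of_tendsto h2 (eventually_nhdsWithin_of_forall fun s hs => h1 s hs)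
  have h4 := D.nonneg w
  have : f = u + w := by simp [hw]
  rw [this, map_add, LinearMap.add_apply]
  linarith

namespace IsSemigroup

/-- The squared distance from `P_s f` to `{0 ≤ g ≤ 1}` is non-increasing: its upper right derivative
is at most `2⟨w, L P_s f⟩ = -2 D(P_s f, w) ≤ 0`, where `w` is the residual of the projection. -/
lemma norm_sub_unitContraction_apply_le_of_isGenerator (hP : D.IsSemigroup P)
    (hM : D.IsMarkovian) {f g : Lp ℝ 2 π} (h : D.IsGenerator f g) {t : ℝ} (ht : 0 ≤ t) :
    ‖P t f - unitContraction (P t f)‖ ≤ ‖f - unitContraction f‖ := by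
  have hcont : ContinuousOn (fun s => ‖P s f - unitContraction (P s f)‖ ^ 2) (Icc 0 t) := by
    have h1 := hP.continuousOn_apply f (b := t) le_rfl
    exact ((h1.sub (continuous_unitContraction.comp_continuousOn h1)).norm).pow 2
  have := image_le_of_liminf_slope_right_le_deriv_boundary
    (f := fun s => ‖P s f - unitContraction (P s f)‖ ^ 2) hcont
    (B := fun _ => ‖f - unitContraction f‖ ^ 2) (B' := fun _ => 0)
    (by simp [hP.zero_apply]) continuousOn_const (fun x _ => hasDerivWithinAt_const _ _ _)
    (fun s hs r hr => by
      have hgen := hP.isGenerator_apply h hs.1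
      obtain ⟨hmem, hform⟩ := hgen
      obtain ⟨hw, hpos⟩ := hM.form_sub_nonneg ⟨P s f, hmem⟩
      rw [hform] at hpos
      -- The projected point is frozen at time `s`. As a competitor at later times it bounds the
      -- distance from above, so the projection itself need not be differentiated.
      have hd : HasDerivWithinAt (fun z => ‖P z f - unitContraction (P s f)‖ ^ 2)
          (2 * inner ℝ (P s f - unitContraction (P s f)) (P s g)) (Ici s) s :=
        ((hP.hasDerivWithinAt h hs.1).sub_const _).norm_sq
      have hlt : 2 * inner ℝ (P s f - unitContraction (P s f)) (P s g) < r := by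
        rw [real_inner_comm]
        simp only at hpos
        linarith
      rw [hasDerivWithinAt_iff_tendsto_slope, Ici_sdiff_left] at hd
      refine Eventually.frequently ?_
      filter_upwards [hd.eventually_lt_const hlt, self_mem_nhdsWithin] with z hz (hsz : s < z)
      refine lt_of_le_of_lt ?_ hz
      rw [slope_def_field, slope_def_field]
      have : 0 < z - s := sub_pos.2 hsz
      gcongr
      exact norm_sub_unitContraction_le _ _) (right_mem_Icc.2 ht)
  exact le_of_sq_le_sq this (norm_nonneg _)

lemma norm_sub_unitContraction_apply_le (hP : D.IsSemigroup P) (hM : D.IsMarkovian) {t : ℝ}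
    (ht : 0 ≤ t) (f : Lp ℝ 2 π) :
    ‖P t f - unitContraction (P t f)‖ ≤ ‖f - unitContraction f‖ := by
  have hu := continuous_unitContraction (π := π)
  have hc : IsClosed {f : Lp ℝ 2 π |
      ‖P t f - unitContraction (P t f)‖ ≤ ‖f - unitContraction f‖} :=
    isClosed_le (by fun_prop) (by fun_prop)
  exact hP.dense_generator.induction
    (fun f ⟨_, h⟩ => hP.norm_sub_unitContraction_apply_le_of_isGenerator hM h ht) hc f

lemma unitContraction_apply (hP : D.IsSemigroup P) (hM : D.IsMarkovian) {t : ℝ}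
    (ht : 0 ≤ t) {f : Lp ℝ 2 π} (h0 : 0 ≤ f) (h1 : f ≤ Lp.const 2 π (1 : ℝ)) :
    unitContraction (P t f) = P t f := by
  have := hP.norm_sub_unitContraction_apply_le hM ht f
  rw [unitContraction_eq_self h0 h1, sub_self, norm_zero, norm_le_zero_iff, sub_eq_zero] at this
  exact this.symm

/-- The semigroup of a Markovian form preserves positivity. -/
lemma apply_nonneg (hP : D.IsSemigroup P) (hM : D.IsMarkovian) {t : ℝ} (ht : 0 ≤ t)
    {f : Lp ℝ 2 π} (hf : 0 ≤ f) : 0 ≤ P t f := by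
  have hc : IsClosed {g : { g : Lp ℝ 2 π // 0 ≤ g } | 0 ≤ P t g} :=
    isClosed_le continuous_const (by fun_prop)
  -- Non-negative simple functions are dense among non-negative elements and bounded, so they can be
  -- rescaled into `[0, 1]`.
  refine (Lp.simpleFunc.denseRange_coeSimpleFuncNonnegToLpNonneg 2 π ℝ
    ENNReal.ofNat_ne_top).induction_on (p := fun g => 0 ≤ P t g) ⟨f, hf⟩ hc ?_
  rintro ⟨s, hs⟩
  change 0 ≤ P t (s : Lp ℝ 2 π)
  replace hs : 0 ≤ (s : Lp ℝ 2 π) := hs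
  obtain ⟨C, hC⟩ := (Lp.simpleFunc.toSimpleFunc s).exists_forall_norm_le
  set c := max C 1
  have hc0 : 0 < c := lt_max_of_lt_right one_pos
  have h0 : 0 ≤ c⁻¹ • (s : Lp ℝ 2 π) := Lp.real_smul_nonneg (by positivity) hs
  have h1 : c⁻¹ • (s : Lp ℝ 2 π) ≤ Lp.const 2 π (1 : ℝ) := by
    rw [← Lp.coeFn_le]
    filter_upwards [Lp.coeFn_smul c⁻¹ (s : Lp ℝ 2 π), Lp.simpleFunc.toSimpleFunc_eq_toFun s]
      with x h1 h2
    rw [h1, Pi.smul_apply, ← h2, smul_eq_mul]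
    have := (le_abs_self _).trans ((hC x).trans (le_max_left C 1))
    have h3 : c⁻¹ * Lp.simpleFunc.toSimpleFunc s x ≤ 1 := by
      rw [inv_mul_le_iff₀ hc0, mul_one]; exact this
    simpa using h3
  have h2 := hP.unitContraction_apply hM ht h0 h1
  have h3 : 0 ≤ P t (c⁻¹ • (s : Lp ℝ 2 π)) := by
    rw [← h2, unitContraction]
    refine le_inf le_sup_right ?_
    rw [← Lp.coeFn_le]
    exact Eventually.of_forall fun x => by simp
  have h4 : P t (s : Lp ℝ 2 π) = c • P t (c⁻¹ • (s : Lp ℝ 2 π)) := by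
    rw [map_smul, smul_smul, mul_inv_cancel₀ hc0.ne', one_smul]
  rw [h4]
  exact Lp.real_smul_nonneg hc0.le h3

lemma apply_mono (hP : D.IsSemigroup P) (hM : D.IsMarkovian) {t : ℝ} (ht : 0 ≤ t)
    {f g : Lp ℝ 2 π} (hfg : f ≤ g) : P t f ≤ P t g := by
  have := hP.apply_nonneg hM ht (sub_nonneg.2 hfg)
  rwa [map_sub, sub_nonneg] at this

end IsSemigroup

/-! ### Jensen's inequality and `L^r` contraction -/

/-- The maximum of `0` and the first `n` affine functions `l i * x + c i`. -/
noncomputable def maxAffine (l c : ℕ → ℝ) : ℕ → ℝ → ℝ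
  | 0 => fun _ => 0
  | n + 1 => fun x => max (maxAffine l c n x) (l n * x + c n)

/-- `maxAffine` composed with an element of `L²`. -/
noncomputable def maxAffineLp (l c : ℕ → ℝ) (f : Lp ℝ 2 π) : ℕ → Lp ℝ 2 π
  | 0 => 0
  | n + 1 => maxAffineLp l c f n ⊔ (l n • f + c n • Lp.const 2 π (1 : ℝ))

lemma maxAffine_nonneg (l c : ℕ → ℝ) (n : ℕ) (x : ℝ) : 0 ≤ maxAffine l c n x := by
  induction n with
  | zero => exact le_rfl
  | succ n ih => exact ih.trans (le_max_left _ _)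

lemma maxAffine_mono (l c : ℕ → ℝ) (x : ℝ) : Monotone fun n => maxAffine l c n x :=
  monotone_nat_of_le_succ fun _ => le_max_left _ _

lemma measurable_maxAffine (l c : ℕ → ℝ) (n : ℕ) : Measurable (maxAffine l c n) := by
  induction n with
  | zero => exact measurable_const
  | succ n ih => exact ih.max (by fun_prop)

lemma maxAffine_le {l c : ℕ → ℝ} {φ : ℝ → ℝ} (h0 : ∀ x, 0 ≤ φ x)
    (h : ∀ n x, l n * x + c n ≤ φ x) (n : ℕ) (x : ℝ) : maxAffine l c n x ≤ φ x := by
  induction n with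
  | zero => exact h0 x
  | succ n ih => exact max_le ih (h n x)

lemma coeFn_maxAffineLp (l c : ℕ → ℝ) (f : Lp ℝ 2 π) (n : ℕ) :
    maxAffineLp l c f n =ᵐ[π] fun x => maxAffine l c n (f x) := by
  induction n with
  | zero => exact Lp.coeFn_zero ℝ 2 π
  | succ n ih =>
    filter_upwards [ih, Lp.coeFn_sup (maxAffineLp l c f n)
      (l n • f + c n • Lp.const 2 π (1 : ℝ)), Lp.coeFn_add (l n • f)
      (c n • Lp.const 2 π (1 : ℝ)), Lp.coeFn_smul (l n) f,
      Lp.coeFn_smul (c n) (Lp.const 2 π (1 : ℝ))] with x h1 h2 h3 h4 h5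
    rw [maxAffineLp, h2, Pi.sup_apply, h1, h3, Pi.add_apply, h4, h5]
    simp [maxAffine]

lemma exists_affine_seq {φ : ℝ → ℝ} (hc : Continuous φ) (hφ : ConvexOn ℝ univ φ) :
    ∃ l c : ℕ → ℝ, (∀ n x, l n * x + c n ≤ φ x) ∧ ∀ x, ⨆ n, l n * x + c n = φ x := by
  obtain ⟨l, c, h1, h2⟩ := hφ.real_univ_sSup_of_nat_affine_eq hc.lowerSemicontinuous
  have e : ∀ n x, l n 1 * x + c n = (l n + Function.const ℝ (c n) : ℝ → ℝ) x := by
    intro n x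
    have : l n x = x * l n 1 := by
      conv_lhs => rw [← mul_one x, ← smul_eq_mul, map_smul, smul_eq_mul]
    simp [this, mul_comm]
  refine ⟨fun n => l n 1, c, fun n x => ?_, fun x => ?_⟩
  · rw [e]; exact h1 n x
  · simp_rw [e]
    rw [← iSup_apply, h2]

lemma iSup_ofReal_maxAffine {l c : ℕ → ℝ} {φ : ℝ → ℝ} (h0 : ∀ x, 0 ≤ φ x)
    (h : ∀ n x, l n * x + c n ≤ φ x) (hsup : ∀ x, ⨆ n, l n * x + c n = φ x) (x : ℝ) :
    ⨆ n, ENNReal.ofReal (maxAffine l c n x) = ENNReal.ofReal (φ x) := by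
  refine le_antisymm (iSup_le fun n => ENNReal.ofReal_le_ofReal (maxAffine_le h0 h n x)) ?_
  have hfin : ⨆ n, ENNReal.ofReal (maxAffine l c n x) ≠ ∞ :=
    ne_top_of_le_ne_top ENNReal.ofReal_ne_top
      (iSup_le fun n => ENNReal.ofReal_le_ofReal (maxAffine_le h0 h n x))
  refine ENNReal.ofReal_le_of_le_toReal ?_
  rw [← hsup x]
  refine ciSup_le fun n => ?_
  refine (le_max_right (maxAffine l c n x) _).trans ?_
  refine (ENNReal.ofReal_le_iff_le_toReal hfin).1 ?_
  -- The index is `n + 1`, the first at which the affine function number `n` is included in the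
  -- maximum.
  exact le_iSup (fun n => ENNReal.ofReal (maxAffine l c n x)) (n + 1)

namespace IsSemigroup

/-- Since `P_t` fixes constants it commutes with affine functions, and by monotonicity the image of
a maximum dominates the maximum of the images. -/
lemma maxAffineLp_apply_le (hP : D.IsSemigroup P) (hD : D.IsConservative) (hM : D.IsMarkovian)
    {t : ℝ} (ht : 0 ≤ t) (l c : ℕ → ℝ) (f : Lp ℝ 2 π) (n : ℕ) :
    maxAffineLp l c (P t f) n ≤ P t (maxAffineLp l c f n) := by
  induction n with
  | zero => simp [maxAffineLp]
  | succ n ih =>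
    refine sup_le (ih.trans (hP.apply_mono hM ht le_sup_left)) ?_
    have : l n • P t f + c n • Lp.const 2 π (1 : ℝ) =
        P t (l n • f + c n • Lp.const 2 π (1 : ℝ)) := by
      rw [map_add, map_smul, map_smul, hP.apply_const_one hD ht]
    rw [this]
    exact hP.apply_mono hM ht le_sup_right

/-- Integrated Jensen inequality for the semigroup of a Markovian form. -/
theorem lintegral_convex_apply_le (hP : D.IsSemigroup P) (hD : D.IsConservative)
    (hM : D.IsMarkovian) {t : ℝ} (ht : 0 ≤ t) {φ : ℝ → ℝ} (h0 : ∀ x, 0 ≤ φ x)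
    (hc : Continuous φ) (hφ : ConvexOn ℝ univ φ) (f : Lp ℝ 2 π) :
    ∫⁻ x, ENNReal.ofReal (φ (P t f x)) ∂π ≤ ∫⁻ x, ENNReal.ofReal (φ (f x)) ∂π := by
  obtain ⟨l, c, hle, hsup⟩ := exists_affine_seq hc hφ
  have hlint : ∀ (g : Lp ℝ 2 π) (n : ℕ), ∫⁻ x, ENNReal.ofReal (maxAffine l c n (g x)) ∂π =
      ENNReal.ofReal (∫ x, maxAffineLp l c g n x ∂π) := by
    intro g n
    have hco := coeFn_maxAffineLp l c g n
    rw [ofReal_integral_eq_lintegral_ofReal ((Lp.memLp _).integrable one_le_two)]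
    · refine lintegral_congr_ae ?_
      filter_upwards [hco] with x hx
      rw [hx]
    · filter_upwards [hco] with x hx
      rw [hx]
      exact maxAffine_nonneg _ _ _ _
  -- Monotone convergence reduces the claim to finite maxima, whose integrals are finite and
  -- preserved by `P_t`; `φ` composed with `f` need not be integrable.
  simp_rw [← iSup_ofReal_maxAffine h0 hle hsup]
  rw [lintegral_iSup' (f := fun n x => ENNReal.ofReal (maxAffine l c n (P t f x)))
    (fun n => ((measurable_maxAffine l c n).comp_aemeasurable
    (Lp.aestronglyMeasurable _).aemeasurable).ennreal_ofReal)
    (Eventually.of_forall fun x m n hmn => ENNReal.ofReal_le_ofReal (maxAffine_mono l c _ hmn))]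
  refine iSup_le fun n => ?_
  calc ∫⁻ x, ENNReal.ofReal (maxAffine l c n (P t f x)) ∂π
      = ENNReal.ofReal (∫ x, maxAffineLp l c (P t f) n x ∂π) := hlint _ n
    _ ≤ ENNReal.ofReal (∫ x, P t (maxAffineLp l c f n) x ∂π) := by
      refine ENNReal.ofReal_le_ofReal (integral_mono_ae ((Lp.memLp _).integrable one_le_two)
        ((Lp.memLp _).integrable one_le_two) ?_)
      exact (Lp.coeFn_le _ _).2 (hP.maxAffineLp_apply_le hD hM ht l c f n)
    _ = ∫⁻ x, ENNReal.ofReal (maxAffine l c n (f x)) ∂π := by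
      rw [hP.integral_apply hD ht, hlint]
    _ ≤ _ := lintegral_mono fun x =>
      le_iSup (fun n => ENNReal.ofReal (maxAffine l c n (f x))) n

lemma eLpNorm_top_apply_le (hP : D.IsSemigroup P) (hD : D.IsConservative) (hM : D.IsMarkovian)
    {t : ℝ} (ht : 0 ≤ t) (f : Lp ℝ 2 π) : eLpNorm (P t f) ∞ π ≤ eLpNorm f ∞ π := by
  by_cases htop : eLpNorm f ∞ π = ∞
  · rw [htop]; exact le_top
  set o := Lp.const 2 π (1 : ℝ)
  set M := (eLpNorm f ∞ π).toReal
  have hf : ∀ᵐ x ∂π, |f x| ≤ M := by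
    rw [eLpNorm_exponent_top] at htop
    filter_upwards [ae_le_eLpNormEssSup (f := f) (μ := π)] with x hx
    have := ENNReal.toReal_mono htop hx
    simpa [M, eLpNorm_exponent_top] using this
  have hsmul : ∀ c : ℝ, ∀ᵐ x ∂π, (c • o : Lp ℝ 2 π) x = c := by
    intro c
    filter_upwards [Lp.coeFn_smul c o] with x hx
    rw [hx]
    simp [o]
  have hPo : ∀ c : ℝ, P t (c • o) = c • o := fun c => by
    rw [map_smul, hP.apply_const_one hD ht]
  -- The `L^∞` bound follows by applying the order-preserving `P_t` to `-M ≤ f ≤ M`, whose end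
  -- points it fixes.
  have h1 : f ≤ M • o := by
    rw [← Lp.coeFn_le]
    filter_upwards [hf, hsmul M] with x hx h
    rw [h]; exact (abs_le.1 hx).2
  have h2 : (-M) • o ≤ f := by
    rw [← Lp.coeFn_le]
    filter_upwards [hf, hsmul (-M)] with x hx h
    rw [h]; exact (abs_le.1 hx).1
  have h3 := hP.apply_mono hM ht h1
  have h4 := hP.apply_mono hM ht h2
  rw [hPo, ← Lp.coeFn_le] at h3 h4
  rw [← ENNReal.ofReal_toReal htop, eLpNorm_exponent_top]
  refine eLpNormEssSup_le_of_ae_bound ?_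
  filter_upwards [h3, h4, hsmul M, hsmul (-M)] with x h3 h4 h5 h6
  rw [h5] at h3
  rw [h6] at h4
  exact abs_le.2 ⟨h4, h3⟩

/-- The semigroup of a Markovian form contracts every `L^r`-norm, `1 ≤ r ≤ ∞`. -/
theorem eLpNorm_apply_le (hP : D.IsSemigroup P) (hD : D.IsConservative) (hM : D.IsMarkovian)
    {r : ℝ≥0∞} (hr : 1 ≤ r) {t : ℝ} (ht : 0 ≤ t) (f : Lp ℝ 2 π) :
    eLpNorm (P t f) r π ≤ eLpNorm f r π := by
  rcases eq_or_ne r ∞ with rfl | hr'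
  · exact hP.eLpNorm_top_apply_le hD hM ht f
  have hr0 : r ≠ 0 := (zero_lt_one.trans_le hr).ne'
  have hr1 : 1 ≤ r.toReal := by simpa using ENNReal.toReal_mono hr' hr
  have hrp : 0 < r.toReal := by linarith
  have hconv : ConvexOn ℝ univ fun x : ℝ => |x| ^ r.toReal := by
    have h1 : ConvexOn ℝ univ fun x : ℝ => ‖x‖ := convexOn_univ_norm
    have h2 := convexOn_rpow hr1
    refine ⟨convex_univ, fun x _ y _ a b ha hb hab => ?_⟩
    have h3 := h1.2 (mem_univ x) (mem_univ y) ha hb hab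
    simp only [Real.norm_eq_abs] at h3
    exact (Real.rpow_le_rpow (abs_nonneg _) h3 hrp.le).trans
      (h2.2 (abs_nonneg x) (abs_nonneg y) ha hb hab)
  have h := hP.lintegral_convex_apply_le hD hM ht (φ := fun x => |x| ^ r.toReal)
    (fun x => by positivity) (by fun_prop (disch := positivity)) hconv f
  have e : ∀ x : ℝ, ENNReal.ofReal (|x| ^ r.toReal) = ‖x‖ₑ ^ r.toReal := fun x => by
    rw [← ENNReal.ofReal_rpow_of_nonneg (abs_nonneg x) hrp.le, Real.enorm_eq_ofReal_abs]
  simp_rw [e] at h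
  rw [eLpNorm_eq_lintegral_rpow_enorm_toReal hr0 hr',
    eLpNorm_eq_lintegral_rpow_enorm_toReal hr0 hr']
  gcongr

end IsSemigroup

end SymmetricForm

theorem mainTheorem4 {E : Type*} [MeasurableSpace E] (π : Measure E) [IsProbabilityMeasure π]
    (D : SymmetricForm π) (hD : D.IsConservative)
    (P : ℝ → Lp ℝ 2 π →L[ℝ] Lp ℝ 2 π) (hP : D.IsSemigroup P) :
    -- Liggett–Stroock inequality implies algebraic decay, and conversely
    (∀ (p q : ℝ), p.HolderConjugate q → ∀ V : Lp ℝ 2 π → ℝ≥0∞,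
      ((∀ t : ℝ, 0 ≤ t → ∀ f, V (P t f) ≤ V f) →
        (∃ C : ℝ, 0 < C ∧ D.LiggettStroock V p q C) →
          ∃ C : ℝ, 0 < C ∧ AlgebraicDecay P V q C) ∧
      ((∃ C : ℝ, 0 < C ∧ AlgebraicDecay P V q C) →
        ∃ C : ℝ, 0 < C ∧ D.LiggettStroock V p q C)) ∧
    -- the contraction hypothesis is automatic for squared `L^r`-norms when the form is Markovian
    (D.IsMarkovian → ∀ r : ℝ≥0∞, 1 ≤ r → ∀ t : ℝ, 0 ≤ t → ∀ f : Lp ℝ 2 π,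
      eLpNorm (P t f) r π ^ 2 ≤ eLpNorm f r π ^ 2) ∧
    -- Poincaré inequality is equivalent to exponential decay, with matching constants
    (∀ c : ℝ, 0 < c → (D.Poincare c⁻¹ ↔ ExponentialDecay P c)) ∧
    ((∃ C : ℝ, 0 < C ∧ D.Poincare C) ↔
      0 < D.spectralGap ∧ ExponentialDecay P D.spectralGap.toReal) := by
  refine ⟨fun p q hpq V => ⟨?_, ?_⟩, ?_, fun c hc => hP.poincare_iff_exponentialDecay hD hc,
    hP.exists_poincare_iff hD⟩
  · rintro hV ⟨C, hC, h⟩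
    exact ⟨_, by positivity, hP.algebraicDecay_of_liggettStroock hD hpq hV hC h⟩
  · rintro ⟨C, hC, h⟩
    exact ⟨C + 2, by positivity, hP.liggettStroock_of_algebraicDecay hD hpq h⟩
  · intro hM r hr t ht f
    exact pow_le_pow_left' (hP.eLpNorm_apply_le hD hM hr ht f) 2
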